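/- Let $d\ge 0$ and $[d]=\{1,\dots,d\}$. A polytope is the convex hull of a finite set. Let $\Pi_d=\operatorname{conv}\{(\sigma(1),\dots,\sigma(d)):\sigma\in S_d\}\subset\mathbb{R}^d$, and let $\mathcal{P}_d$ be the class of generalized permutahedra, i.e. of all polytopes $P\subset\mathbb{R}^d$ for which there are $r>0$ and a polytope $Q$ with $Q+P=r\,\Pi_d$ (Minkowski sum). In particular the members of $\mathcal{P}_d$ are nonempty. Put $\Delta_\emptyset=\{0\}$ and $\Delta_I=\operatorname{conv}\{e_i: i\in I\}$ for $\emptyset\ne I\subseteq[d]$; these belong to $\mathcal{P}_d$. A function $\varphi\colon\mathcal{P}_d\to\mathbb{R}$ is Minkowski linear if $\varphi(\lambda P+\mu Q)=\lambda\varphi(P)+\mu\varphi(Q)$ for all $P,Q\in\mathcal{P}_d$ and all $\lambda,\mu\ge 0$; positive if $\varphi(P)\ge 0$ for all $P\in\mathcal{P}_d$; translation-invariant if $\varphi(P+t)=\varphi(P)$ for all $P\in\mathcal{P}_d$, $t\in\mathbb{R}^d$. Theorem 3.1. For all $E\subseteq T\subseteq[d]$ with $|E|=2$ there is a unique Minkowski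 linear functional $v_E^T\colon\mathcal{P}_d\to\mathbb{R}$ such that, for every $I\subseteq[d]$, $$v_E^T(\Delta_I)=\begin{cases}1 & \text{if } E\subseteq I\subseteq T,\\ 0 & \text{otherwise.}\end{cases}$$ A Minkowski linear functional $\varphi\colon\mathcal{P}_d\to\mathbb{R}$ is positive and translation-invariant if and only if there are real numbers $c_E^T\ge 0$ such that $$\varphi=\sum_{E\subseteq[d],\,|E|=2}\ \sum_{T:\,E\subseteq T\subseteq[d]}c_E^T\,v_E^T .$$ In particular, the positive, translation-invariant Minkowski linear functionals form a polyhedral cone (an intersection of finitely many closed linear half-spaces) in the real vector space of all Minkowski linear functionals on $\mathcal{P}_d$. The rays of this cone (its faces of the form $\{c\psi: c\ge 0\}$ with $\psi\neq 0$) are exactly the half-lines $\{c\,v_E^T: c\ge 0\}$, and different pairs $(E,T)$ give different rays. -/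

import Mathlib

open scoped Pointwise NNReal

noncomputable section

namespace GenPermutahedra

/-- A polytope in `ℝ^d`: the convex hull of a finite set of points. -/
def IsPolytope {d : ℕ} (P : Set (Fin d → ℝ)) : Prop :=
  ∃ s : Set (Fin d → ℝ), s.Finite ∧ P = convexHull ℝ s

/-- The point `(σ(1), …, σ(d))`; since `Fin d` is `{0, …, d-1}`, every entry is shifted by one. -/
def permPoint {d : ℕ} (σ : Equiv.Perm (Fin d)) : Fin d → ℝ :=
  fun i => ((σ i : ℕ) : ℝ) + 1

/-- The standard permutahedron `Π_d`. -/
def permutahedron (d : ℕ) : Set (Fin d → ℝ) :=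
  convexHull ℝ (Set.range (permPoint (d := d)))

/-- `R` is a Minkowski summand of `Q`: there is a polytope `P` with `P + R = Q`. -/
def IsMinkowskiSummand {d : ℕ} (R Q : Set (Fin d → ℝ)) : Prop :=
  ∃ P : Set (Fin d → ℝ), IsPolytope P ∧ P + R = Q

/-- `R` is a weak Minkowski summand of `Q`: it is a Minkowski summand of a dilate of `Q` by a
positive factor. -/
def IsWeakMinkowskiSummand {d : ℕ} (R Q : Set (Fin d → ℝ)) : Prop :=
  ∃ r : ℝ, 0 < r ∧ IsMinkowskiSummand R (r • Q)

/-- A generalized permutahedron in `ℝ^d`: a polytope that is a weak Minkowski summand of `Π_d`. -/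
def IsGenPerm {d : ℕ} (P : Set (Fin d → ℝ)) : Prop :=
  IsPolytope P ∧ IsWeakMinkowskiSummand P (permutahedron d)

theorem IsPolytope.add {d : ℕ} {P Q : Set (Fin d → ℝ)} (hP : IsPolytope P) (hQ : IsPolytope Q) :
    IsPolytope (P + Q) := by
  obtain ⟨s, hs, rfl⟩ := hP
  obtain ⟨t, ht, rfl⟩ := hQ
  exact ⟨s + t, hs.add ht, (convexHull_add s t).symm⟩

theorem IsPolytope.smul {d : ℕ} {P : Set (Fin d → ℝ)} (hP : IsPolytope P) (a : ℝ) :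
    IsPolytope (a • P) := by
  obtain ⟨s, hs, rfl⟩ := hP
  exact ⟨a • s, hs.smul_set, (convexHull_smul a s).symm⟩

theorem isPolytope_singleton {d : ℕ} (t : Fin d → ℝ) : IsPolytope ({t} : Set (Fin d → ℝ)) :=
  ⟨{t}, Set.finite_singleton t, (convexHull_singleton t).symm⟩

theorem isPolytope_permutahedron (d : ℕ) : IsPolytope (permutahedron d) :=
  ⟨_, Set.finite_range _, rfl⟩

theorem convex_permutahedron (d : ℕ) : Convex ℝ (permutahedron d) := convex_convexHull ℝ _

theorem IsGenPerm.add {d : ℕ} {P Q : Set (Fin d → ℝ)} (hP : IsGenPerm P) (hQ : IsGenPerm Q) :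
    IsGenPerm (P + Q) := by
  obtain ⟨hP, a, ha, R, hR, hPR⟩ := hP
  obtain ⟨hQ, b, hb, S, hS, hQS⟩ := hQ
  refine ⟨hP.add hQ, a + b, add_pos ha hb, R + S, hR.add hS, ?_⟩
  rw [(convex_permutahedron d).add_smul ha.le hb.le, ← hPR, ← hQS]
  exact add_add_add_comm R S P Q

theorem isGenPerm_singleton {d : ℕ} (t : Fin d → ℝ) : IsGenPerm ({t} : Set (Fin d → ℝ)) := by
  refine ⟨isPolytope_singleton t, 1, one_pos, permutahedron d + {-t},
    (isPolytope_permutahedron d).add (isPolytope_singleton _), ?_⟩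
  rw [add_assoc, Set.singleton_add_singleton, neg_add_cancel, one_smul]
  exact add_zero _

theorem IsGenPerm.nonempty {d : ℕ} {P : Set (Fin d → ℝ)} (hP : IsGenPerm P) : P.Nonempty := by
  obtain ⟨-, a, -, R, -, hPR⟩ := hP
  have h : (R + P).Nonempty := by
    rw [hPR]
    exact ((Set.range_nonempty _).convexHull).smul_set
  exact h.of_add_right

theorem IsGenPerm.smul {d : ℕ} {P : Set (Fin d → ℝ)} (hP : IsGenPerm P) (c : ℝ≥0) :
    IsGenPerm ((c : ℝ) • P) := by
  rcases eq_or_ne c 0 with rfl | hc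
  · rw [NNReal.coe_zero, Set.zero_smul_set hP.nonempty]
    exact isGenPerm_singleton 0
  · obtain ⟨hP, a, ha, R, hR, hPR⟩ := hP
    have hc' : 0 < (c : ℝ) := NNReal.coe_pos.2 (pos_iff_ne_zero.2 hc)
    refine ⟨hP.smul _, (c : ℝ) * a, mul_pos hc' ha, (c : ℝ) • R, hR.smul _, ?_⟩
    rw [← smul_add, hPR, smul_smul]

theorem IsGenPerm.translate {d : ℕ} {P : Set (Fin d → ℝ)} (hP : IsGenPerm P) (t : Fin d → ℝ) :
    IsGenPerm ((fun x => x + t) '' P) := by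
  rw [← Set.add_singleton]
  exact hP.add (isGenPerm_singleton t)

/-- The class `𝒫_d` of all generalized permutahedra in `ℝ^d`. -/
def GenPerm (d : ℕ) : Type := {P : Set (Fin d → ℝ) // IsGenPerm P}

/-- Minkowski sum of generalized permutahedra. -/
instance (d : ℕ) : Add (GenPerm d) := ⟨fun P Q => ⟨P.1 + Q.1, P.2.add Q.2⟩⟩

/-- Dilate `c P = {c x : x ∈ P}` of a generalized permutahedron, `c ≥ 0`. -/
instance (d : ℕ) : SMul ℝ≥0 (GenPerm d) := ⟨fun c P => ⟨(c : ℝ) • P.1, P.2.smul c⟩⟩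

/-- The translate `P + t`. -/
def GenPerm.translate {d : ℕ} (P : GenPerm d) (t : Fin d → ℝ) : GenPerm d :=
  ⟨(fun x => x + t) '' P.1, P.2.translate t⟩

/-- The standard simplex `Δ_I = conv {e_i : i ∈ I}` for nonempty `I`, and `Δ_∅ = {0}`. -/
def simplexSet {d : ℕ} (I : Finset (Fin d)) : Set (Fin d → ℝ) :=
  if I.Nonempty then convexHull ℝ ((fun i => Pi.single i (1 : ℝ)) '' (I : Set (Fin d))) else {0}

theorem permPoint_exchange {d : ℕ} (σ : Equiv.Perm (Fin d)) (i m : Fin d) (h : σ i ≤ σ m) :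
    permPoint σ - Pi.single m 1 + Pi.single i 1 ∈ permutahedron d := by
  have hmem : ∀ τ : Equiv.Perm (Fin d), permPoint τ ∈ permutahedron d :=
    fun τ => subset_convexHull ℝ _ ⟨τ, rfl⟩
  rcases eq_or_ne i m with rfl | him
  · simpa using hmem σ
  have hlt : σ i < σ m := lt_of_le_of_ne h fun e => him (σ.injective e)
  have h1 : (1 : ℝ) ≤ ((σ m : ℕ) : ℝ) - ((σ i : ℕ) : ℝ) := by
    have : ((σ i : ℕ) : ℝ) + 1 ≤ ((σ m : ℕ) : ℝ) := by exact_mod_cast hlt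
    linarith
  have h0 : (0 : ℝ) < ((σ m : ℕ) : ℝ) - ((σ i : ℕ) : ℝ) := by linarith
  have hseg := convex_permutahedron d (hmem σ) (hmem (Equiv.swap i m |>.trans σ))
    (a := 1 - (((σ m : ℕ) : ℝ) - ((σ i : ℕ) : ℝ))⁻¹) (b := (((σ m : ℕ) : ℝ) - ((σ i : ℕ) : ℝ))⁻¹)
    (by linarith [inv_le_one_of_one_le₀ h1]) (by positivity) (by ring)
  convert hseg using 1
  funext k
  simp only [permPoint, Pi.add_apply, Pi.sub_apply, Pi.smul_apply, smul_eq_mul,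
    Equiv.trans_apply, Pi.single_apply]
  rcases eq_or_ne k i with rfl | hki
  · simp only [him, if_true, if_false, Equiv.swap_apply_left]
    field_simp
    ring
  rcases eq_or_ne k m with rfl | hkm
  · simp only [hki, if_true, if_false, Equiv.swap_apply_right]
    field_simp
    ring
  · simp only [hki, hkm, if_false, Equiv.swap_apply_of_ne_of_ne hki hkm]
    ring

theorem isGenPerm_simplexSet {d : ℕ} (I : Finset (Fin d)) : IsGenPerm (simplexSet I) := by
  unfold simplexSet
  split_ifs with hI
  · refine ⟨⟨_, I.finite_toSet.image _, rfl⟩, 1, one_pos, ?_⟩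
    have hex : ∀ σ : Equiv.Perm (Fin d), ∃ m ∈ I, ∀ i ∈ I, σ i ≤ σ m :=
      fun σ => I.exists_max_image σ hI
    choose m hmI hm using hex
    refine ⟨convexHull ℝ (Set.range fun σ => permPoint σ - Pi.single (m σ) 1),
      ⟨_, Set.finite_range _, rfl⟩, ?_⟩
    rw [one_smul, ← convexHull_add]
    apply Set.Subset.antisymm
    · refine convexHull_min ?_ (convex_permutahedron d)
      rintro _ ⟨_, ⟨σ, rfl⟩, _, ⟨i, hi, rfl⟩, rfl⟩
      exact permPoint_exchange σ i (m σ) (hm σ i hi)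
    · refine convexHull_mono ?_
      rintro _ ⟨σ, rfl⟩
      exact ⟨_, ⟨σ, rfl⟩, _, ⟨m σ, hmI σ, rfl⟩, sub_add_cancel _ _⟩
  · exact isGenPerm_singleton 0

/-- The standard simplex `Δ_I` as a member of `𝒫_d`. -/
def simplex {d : ℕ} (I : Finset (Fin d)) : GenPerm d := ⟨simplexSet I, isGenPerm_simplexSet I⟩

/-- Minkowski linearity of `φ : 𝒫_d → ℝ`. -/
def IsMinkowskiLinear {d : ℕ} (φ : GenPerm d → ℝ) : Prop :=
  ∀ (P Q : GenPerm d) (a b : ℝ≥0), φ (a • P + b • Q) = (a : ℝ) * φ P + (b : ℝ) * φ Q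

/-- The real vector space of Minkowski linear functionals on `𝒫_d`, with pointwise operations. -/
def MinkowskiFunctional (d : ℕ) : Submodule ℝ (GenPerm d → ℝ) where
  carrier := {φ | IsMinkowskiLinear φ}
  add_mem' := by
    intro φ ψ hφ hψ P Q a b
    simp only [Pi.add_apply, hφ P Q a b, hψ P Q a b]
    ring
  zero_mem' := by
    intro P Q a b
    simp
  smul_mem' := by
    intro c φ hφ P Q a b
    simp only [Pi.smul_apply, smul_eq_mul, hφ P Q a b]
    ring

def IsPositive {d : ℕ} (φ : GenPerm d → ℝ) : Prop := ∀ P, 0 ≤ φ P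

def IsTranslationInvariant {d : ℕ} (φ : GenPerm d → ℝ) : Prop :=
  ∀ (P : GenPerm d) (t : Fin d → ℝ), φ (P.translate t) = φ P

/-- The family of positive, translation-invariant Minkowski linear functionals, as a convex cone
in the space of all Minkowski linear functionals. -/
def positiveInvariantCone (d : ℕ) : PointedCone ℝ (MinkowskiFunctional d) where
  carrier := {φ | IsPositive φ.1 ∧ IsTranslationInvariant φ.1}
  add_mem' := by
    rintro φ ψ ⟨h1, h2⟩ ⟨h3, h4⟩
    refine ⟨fun P => add_nonneg (h1 P) (h3 P), fun P t => ?_⟩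
    change φ.1 _ + ψ.1 _ = φ.1 _ + ψ.1 _
    rw [h2, h4]
  zero_mem' := ⟨fun _ => le_rfl, fun _ _ => rfl⟩
  smul_mem' := by
    rintro c φ ⟨h1, h2⟩
    refine ⟨fun P => mul_nonneg c.2 (h1 P), fun P t => ?_⟩
    change (c : ℝ) * φ.1 _ = (c : ℝ) * φ.1 _
    rw [h2]

/-- The pairs `(E, T)` of subsets of `[d]` with `|E| = 2` and `E ⊆ T`. -/
abbrev EdgePair (d : ℕ) : Type :=
  {p : Finset (Fin d) × Finset (Fin d) // p.1.card = 2 ∧ p.1 ⊆ p.2}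

/-- The condition that defines the functional `v_E^T` among all Minkowski linear functionals:
`v_E^T (Δ_I)` is `1` if `E ⊆ I ⊆ T`, and `0` otherwise. -/
def HasRayValues {d : ℕ} (p : EdgePair d) (v : MinkowskiFunctional d) : Prop :=
  ∀ I : Finset (Fin d), v.1 (simplex I) = if p.1.1 ⊆ I ∧ I ⊆ p.1.2 then 1 else 0

/-- A polyhedral cone: the intersection of finitely many closed linear half-spaces. -/
def IsPolyhedralCone {M : Type*} [AddCommGroup M] [Module ℝ M] (C : PointedCone ℝ M) : Prop :=
  ∃ s : Set (Module.Dual ℝ M), s.Finite ∧ ∀ x, x ∈ C ↔ ∀ f ∈ s, 0 ≤ f x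

/-- A ray of the cone `C`: a half-line `{c x : c ≥ 0}`, `x ≠ 0`, that is a face of `C`. -/
def IsRayOf {M : Type*} [AddCommGroup M] [Module ℝ M] (R C : PointedCone ℝ M) : Prop :=
  R.IsFaceOf C ∧ ∃ x : M, x ≠ 0 ∧ R = PointedCone.hull ℝ {x}

end GenPermutahedra

end

/-!
The value `supportValue P S` of the support function of a generalized permutahedron `P` at the
indicator vector of `S` carries all the information about `P`. Because `P` is a weak summand of the
permutahedron, a single point of `P` maximizes all linear forms whose coefficients are sorted by a
given permutation (`IsGenPerm.exists_maximizer`). That point is given by the greedy algorithm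
applied to `supportValue P`, and `P` is the convex hull of the greedy points
(`eq_convexHull_greedyPoint`). Set functions of this form are submodular. Conversely, every
submodular set function that vanishes at `∅` comes from a generalized permutahedron
(`IsSubmodular.exists_supportValue_eq`), the complementary summand being obtained from the set
function of a large dilate of the permutahedron minus the given one.

The support values of the simplices `Δ_I` span the set functions that vanish at `∅`. So every `P` is
a signed Minkowski sum of simplices, and a Minkowski linear functional is determined by its values
at them. In particular `v_E^T`, with `E = {i, j}` and `A` the complement of `T`, is the second
difference `h (A ∪ {i}) + h (A ∪ {j}) - h A - h (A ∪ {i, j})` of the support values `h`, which is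
nonnegative by submodularity.

The hull of the `v_E^T` is polyhedral by Fourier–Motzkin elimination (`isPolyhedralCone_hull`). A
linear form on functionals that is nonnegative on all the `v_E^T` is a signed sum of evaluations at
simplices whose set function is submodular, hence it is the evaluation at a generalized
permutahedron, so it is nonnegative at positive functionals. This shows that positive functionals
lie in the hull (`mem_hull_of_isPositive`). The generators are extremal and pairwise not
proportional because for `p ≠ q` some generalized permutahedron annihilates `v p` but not `v q`
(`exists_genPerm_separating`).
-/

namespace GenPermutahedra

variable {d : ℕ}

/-! ### Weight vectors sorted by a permutation -/

/-- `S` is a set of indices on which `σ` takes its largest values: an upper set for the linear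
order on the indices given by `σ`. -/
def IsTopSet (σ : Equiv.Perm (Fin d)) (S : Finset (Fin d)) : Prop :=
  ∀ ⦃i j⦄, i ∈ S → σ i < σ j → j ∈ S

/-- The indices that come after `i` in the order given by `σ`. -/
def indicesAbove (σ : Equiv.Perm (Fin d)) (i : Fin d) : Finset (Fin d) :=
  Finset.univ.filter fun j => σ i < σ j

theorem mem_indicesAbove {σ : Equiv.Perm (Fin d)} {i j : Fin d} :
    j ∈ indicesAbove σ i ↔ σ i < σ j := by
  simp [indicesAbove]

theorem notMem_indicesAbove_self (σ : Equiv.Perm (Fin d)) (i : Fin d) :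
    i ∉ indicesAbove σ i := by
  simp [mem_indicesAbove]

theorem isTopSet_indicesAbove (σ : Equiv.Perm (Fin d)) (i : Fin d) :
    IsTopSet σ (indicesAbove σ i) := by
  intro j k hj hjk
  rw [mem_indicesAbove] at hj ⊢
  exact hj.trans hjk

theorem isTopSet_insert_indicesAbove (σ : Equiv.Perm (Fin d)) (i : Fin d) :
    IsTopSet σ (insert i (indicesAbove σ i)) := by
  intro j k hj hjk
  rw [Finset.mem_insert, mem_indicesAbove] at hj ⊢
  rcases hj with rfl | hj
  · exact Or.inr hjk
  · exact Or.inr (hj.trans hjk)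

theorem isTopSet_univ (σ : Equiv.Perm (Fin d)) : IsTopSet σ Finset.univ :=
  fun _ _ _ _ => Finset.mem_univ _

theorem IsTopSet.monovary {σ : Equiv.Perm (Fin d)} {S : Finset (Fin d)} (h : IsTopSet σ S) :
    Monovary (fun i => if i ∈ S then (1 : ℝ) else 0) σ := by
  intro i j hij
  by_cases hi : i ∈ S
  · simp [hi, h hi hij]
  · simp only [hi, if_false]
    split_ifs <;> norm_num

theorem exists_perm_monovary (w : Fin d → ℝ) : ∃ σ : Equiv.Perm (Fin d), Monovary w σ := by
  refine ⟨(Tuple.sort w)⁻¹, fun i j hij => ?_⟩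
  have := Tuple.monotone_sort w hij.le
  simpa using this

theorem exists_isTopSet (S : Finset (Fin d)) : ∃ σ : Equiv.Perm (Fin d), IsTopSet σ S := by
  obtain ⟨σ, hσ⟩ := exists_perm_monovary fun i => if i ∈ S then (1 : ℝ) else 0
  refine ⟨σ, fun i j hi hij => ?_⟩
  by_contra hj
  have := hσ hij
  simp only [hi, hj, if_true, if_false] at this
  norm_num at this

theorem indicator_dotProduct (S : Finset (Fin d)) (x : Fin d → ℝ) :
    (fun i => if i ∈ S then (1 : ℝ) else 0) ⬝ᵥ x = ∑ i ∈ S, x i := by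
  simp [dotProduct, Finset.sum_ite_mem]

/-! ### Vertices of generalized permutahedra -/

theorem dotProduct_le_of_mem_convexHull {w : Fin d → ℝ} {s : Set (Fin d → ℝ)} {c : ℝ}
    (h : ∀ x ∈ s, w ⬝ᵥ x ≤ c) : ∀ x ∈ convexHull ℝ s, w ⬝ᵥ x ≤ c := by
  have hlin : IsLinearMap ℝ fun x : Fin d → ℝ => w ⬝ᵥ x :=
    ⟨fun x y => dotProduct_add w x y, fun a x => dotProduct_smul a w x⟩
  exact convexHull_min h (convex_halfSpace_le hlin c)

theorem dotProduct_le_permPoint {w : Fin d → ℝ} {σ : Equiv.Perm (Fin d)} (h : Monovary w σ) :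
    ∀ x ∈ permutahedron d, w ⬝ᵥ x ≤ w ⬝ᵥ permPoint σ := by
  refine dotProduct_le_of_mem_convexHull ?_
  rintro _ ⟨τ, rfl⟩
  have hmono : Monovary w (permPoint σ) := by
    intro i j hij
    refine h ?_
    have : ((σ i : ℕ) : ℝ) < ((σ j : ℕ) : ℝ) := by simpa [permPoint] using hij
    exact_mod_cast this
  have := hmono.sum_mul_comp_perm_le_sum_mul (σ := τ.trans σ.symm)
  simpa [permPoint, dotProduct] using this

/-- The normal fan of a generalized permutahedron is refined by the braid arrangement: one point
maximizes all the linear forms whose coefficients are sorted by `σ`. -/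
theorem IsGenPerm.exists_maximizer {P : Set (Fin d → ℝ)} (hP : IsGenPerm P)
    (σ : Equiv.Perm (Fin d)) :
    ∃ p ∈ P, ∀ w : Fin d → ℝ, Monovary w σ → ∀ x ∈ P, w ⬝ᵥ x ≤ w ⬝ᵥ p := by
  obtain ⟨-, r, hr, Q, -, hQP⟩ := hP
  have hmem : r • permPoint σ ∈ Q + P := by
    rw [hQP]
    exact Set.smul_mem_smul_set (subset_convexHull ℝ _ ⟨σ, rfl⟩)
  obtain ⟨q, hq, p, hp, hqp⟩ := hmem
  refine ⟨p, hp, fun w hw x hx => ?_⟩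
  have hx' : q + x ∈ r • permutahedron d := by
    rw [← hQP]
    exact Set.add_mem_add hq hx
  obtain ⟨y, hy, hyx⟩ := hx'
  have h1 := mul_le_mul_of_nonneg_left (dotProduct_le_permPoint hw y hy) hr.le
  have h2 : w ⬝ᵥ (r • y) = w ⬝ᵥ (q + x) := congrArg _ hyx
  have h3 : w ⬝ᵥ (q + p) = w ⬝ᵥ (r • permPoint σ) := congrArg _ hqp
  simp only [dotProduct_add, dotProduct_smul, smul_eq_mul] at h2 h3
  linarith

/-- The value at the indicator vector of `S` of the support function of `P`. -/
noncomputable def supportValue (P : GenPerm d) (S : Finset (Fin d)) : ℝ :=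
  sSup ((fun x : Fin d → ℝ => ∑ i ∈ S, x i) '' P.1)

theorem supportValue_eq {P : GenPerm d} {S : Finset (Fin d)} {p : Fin d → ℝ} (hp : p ∈ P.1)
    (h : ∀ x ∈ P.1, ∑ i ∈ S, x i ≤ ∑ i ∈ S, p i) : supportValue P S = ∑ i ∈ S, p i := by
  refine IsGreatest.csSup_eq ⟨⟨p, hp, rfl⟩, ?_⟩
  rintro _ ⟨x, hx, rfl⟩
  exact h x hx

/-- One point of `P` attains the support value of every top set of `σ`. -/
theorem exists_supportValue_eq (P : GenPerm d) (σ : Equiv.Perm (Fin d)) :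
    ∃ p ∈ P.1, (∀ w : Fin d → ℝ, Monovary w σ → ∀ x ∈ P.1, w ⬝ᵥ x ≤ w ⬝ᵥ p) ∧
      ∀ S, IsTopSet σ S → supportValue P S = ∑ i ∈ S, p i := by
  obtain ⟨p, hp, hmax⟩ := P.2.exists_maximizer σ
  refine ⟨p, hp, hmax, fun S hS => supportValue_eq hp fun x hx => ?_⟩
  simpa only [indicator_dotProduct] using hmax _ hS.monovary x hx

theorem exists_mem_supportValue_eq (P : GenPerm d) (S : Finset (Fin d)) :
    ∃ p ∈ P.1, supportValue P S = ∑ i ∈ S, p i := by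
  obtain ⟨σ, hσ⟩ := exists_isTopSet S
  obtain ⟨p, hp, -, h⟩ := exists_supportValue_eq P σ
  exact ⟨p, hp, h S hσ⟩

theorem sum_le_supportValue (P : GenPerm d) (S : Finset (Fin d)) {x : Fin d → ℝ} (hx : x ∈ P.1) :
    ∑ i ∈ S, x i ≤ supportValue P S := by
  obtain ⟨σ, hσ⟩ := exists_isTopSet S
  obtain ⟨p, hp, hmax, h⟩ := exists_supportValue_eq P σ
  rw [h S hσ]
  simpa only [indicator_dotProduct] using hmax _ hσ.monovary x hx

@[simp]
theorem supportValue_empty (P : GenPerm d) : supportValue P ∅ = 0 := by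
  obtain ⟨p, -, h⟩ := exists_mem_supportValue_eq P ∅
  simpa using h

/-- The point produced by the greedy algorithm for the set function `f`, which adds the indices in
decreasing order of their value under `σ`: each coordinate is the gain in `f` from its index. -/
def greedyPoint (f : Finset (Fin d) → ℝ) (σ : Equiv.Perm (Fin d)) : Fin d → ℝ :=
  fun i => f (insert i (indicesAbove σ i)) - f (indicesAbove σ i)

theorem greedyPoint_mem (P : GenPerm d) (σ : Equiv.Perm (Fin d)) :
    greedyPoint (supportValue P) σ ∈ P.1 ∧
      ∀ w : Fin d → ℝ, Monovary w σ → ∀ x ∈ P.1,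
        w ⬝ᵥ x ≤ w ⬝ᵥ greedyPoint (supportValue P) σ := by
  obtain ⟨p, hp, hmax, h⟩ := exists_supportValue_eq P σ
  have : greedyPoint (supportValue P) σ = p := by
    funext i
    rw [greedyPoint, h _ (isTopSet_insert_indicesAbove σ i), h _ (isTopSet_indicesAbove σ i),
      Finset.sum_insert (notMem_indicesAbove_self σ i)]
    ring
  rw [this]
  exact ⟨hp, hmax⟩

/-- A closed convex set contains every point that satisfies all the linear inequalities valid
for it. -/
theorem mem_of_forall_exists_dotProduct_le {K : Set (Fin d → ℝ)} (hK : Convex ℝ K)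
    (hcl : IsClosed K) {x : Fin d → ℝ} (h : ∀ w : Fin d → ℝ, ∃ y ∈ K, w ⬝ᵥ x ≤ w ⬝ᵥ y) :
    x ∈ K := by
  by_contra hx
  obtain ⟨f, u, hfK, hfx⟩ := geometric_hahn_banach_closed_point hK hcl hx
  have hf : ∀ z, f z = (fun i => f (Pi.single i 1)) ⬝ᵥ z := by
    intro z
    conv_lhs => rw [← Finset.univ_sum_single z]
    rw [map_sum]
    refine Finset.sum_congr rfl fun i _ => ?_
    have : (Pi.single i (z i) : Fin d → ℝ) = z i • Pi.single i 1 := by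
      rw [← Pi.single_smul, smul_eq_mul, mul_one]
    rw [this, map_smul, smul_eq_mul, mul_comm]
  obtain ⟨y, hy, hxy⟩ := h fun i => f (Pi.single i 1)
  rw [← hf, ← hf] at hxy
  linarith [hfK y hy]

theorem eq_convexHull_greedyPoint (P : GenPerm d) :
    P.1 = convexHull ℝ (Set.range (greedyPoint (supportValue P))) := by
  apply Set.Subset.antisymm
  · intro x hx
    refine mem_of_forall_exists_dotProduct_le (convex_convexHull ℝ _)
      ((Set.finite_range _).isClosed_convexHull ℝ) fun w => ?_
    obtain ⟨σ, hσ⟩ := exists_perm_monovary w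
    exact ⟨_, subset_convexHull ℝ _ ⟨σ, rfl⟩, (greedyPoint_mem P σ).2 w hσ x hx⟩
  · have hconv : Convex ℝ P.1 := by
      obtain ⟨⟨s, -, hs⟩, -⟩ := P.2
      rw [hs]
      exact convex_convexHull ℝ _
    refine convexHull_min ?_ hconv
    rintro _ ⟨σ, rfl⟩
    exact (greedyPoint_mem P σ).1

/-- A generalized permutahedron is determined by its support values at indicator vectors. -/
theorem eq_of_supportValue_eq {P Q : GenPerm d} (h : supportValue P = supportValue Q) : P = Q :=
  Subtype.ext <| by rw [eq_convexHull_greedyPoint P, eq_convexHull_greedyPoint Q, h]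

/-! ### Support values of sums, translates and simplices -/

theorem supportValue_linearComb (P Q : GenPerm d) (a b : ℝ≥0) (S : Finset (Fin d)) :
    supportValue (a • P + b • Q) S = a * supportValue P S + b * supportValue Q S := by
  obtain ⟨p, hp, hpS⟩ := exists_mem_supportValue_eq P S
  obtain ⟨q, hq, hqS⟩ := exists_mem_supportValue_eq Q S
  have hsum : ∀ x y : Fin d → ℝ, ∑ i ∈ S, ((a : ℝ) • x + (b : ℝ) • y) i =
      a * ∑ i ∈ S, x i + b * ∑ i ∈ S, y i := by
    intro x y
    simp [Finset.sum_add_distrib, Finset.mul_sum]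
  have hmem : (a : ℝ) • p + (b : ℝ) • q ∈ (a • P + b • Q).1 :=
    Set.add_mem_add (Set.smul_mem_smul_set hp) (Set.smul_mem_smul_set hq)
  rw [supportValue_eq hmem, hsum, hpS, hqS]
  rintro _ ⟨_, ⟨x, hx, rfl⟩, _, ⟨y, hy, rfl⟩, rfl⟩
  refine (hsum x y).trans_le ?_
  rw [hsum, ← hpS, ← hqS]
  have h1 := sum_le_supportValue P S hx
  have h2 := sum_le_supportValue Q S hy
  gcongr

theorem supportValue_translate (P : GenPerm d) (t : Fin d → ℝ) (S : Finset (Fin d)) :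
    supportValue (P.translate t) S = supportValue P S + ∑ i ∈ S, t i := by
  obtain ⟨p, hp, hpS⟩ := exists_mem_supportValue_eq P S
  have hmem : p + t ∈ (P.translate t).1 := ⟨p, hp, rfl⟩
  rw [supportValue_eq hmem]
  · simp [hpS, Finset.sum_add_distrib]
  · rintro _ ⟨x, hx, rfl⟩
    have := sum_le_supportValue P S hx
    simp only [Pi.add_apply, Finset.sum_add_distrib]
    linarith

theorem supportValue_simplex (I S : Finset (Fin d)) :
    supportValue (simplex I) S = if (I ∩ S).Nonempty then 1 else 0 := by
  have hsum : ∀ i, ∑ j ∈ S, (Pi.single i (1 : ℝ) : Fin d → ℝ) j = if i ∈ S then 1 else 0 := by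
    intro i
    simp [Pi.single_apply]
  by_cases hI : I.Nonempty
  · have hset : (simplex I).1 =
        convexHull ℝ ((fun i => Pi.single i (1 : ℝ)) '' (I : Set (Fin d))) := if_pos hI
    have hle : ∀ c : ℝ, (∀ i ∈ I, (if i ∈ S then (1 : ℝ) else 0) ≤ c) →
        ∀ x ∈ (simplex I).1, ∑ j ∈ S, x j ≤ c := by
      intro c hc x hx
      rw [hset] at hx
      rw [← indicator_dotProduct]
      refine dotProduct_le_of_mem_convexHull ?_ x hx
      rintro _ ⟨i, hi, rfl⟩
      rw [indicator_dotProduct, hsum]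
      exact hc i hi
    have hmem : ∀ i ∈ I, (Pi.single i (1 : ℝ) : Fin d → ℝ) ∈ (simplex I).1 := by
      intro i hi
      rw [hset]
      exact subset_convexHull ℝ _ ⟨i, hi, rfl⟩
    by_cases hIS : (I ∩ S).Nonempty
    · obtain ⟨i, hi⟩ := hIS
      rw [Finset.mem_inter] at hi
      rw [if_pos ⟨i, Finset.mem_inter.2 hi⟩, supportValue_eq (hmem i hi.1), hsum, if_pos hi.2]
      rw [hsum, if_pos hi.2]
      exact hle 1 fun j _ => by split_ifs <;> norm_num
    · obtain ⟨i, hi⟩ := hI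
      have hnot : ∀ j ∈ I, j ∉ S := fun j hj hjS => hIS ⟨j, Finset.mem_inter.2 ⟨hj, hjS⟩⟩
      rw [if_neg hIS, supportValue_eq (hmem i hi), hsum, if_neg (hnot i hi)]
      rw [hsum, if_neg (hnot i hi)]
      exact hle 0 fun j hj => by simp [hnot j hj]
  · have hset : (simplex I).1 = {0} := if_neg hI
    obtain ⟨p, hp, hpS⟩ := exists_mem_supportValue_eq (simplex I) S
    rw [hset, Set.mem_singleton_iff] at hp
    rw [Finset.not_nonempty_iff_eq_empty] at hI
    rw [hpS, hp]
    simp [hI]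

/-! ### Submodular set functions -/

/-- The second difference of the set function `f` at `A` in the directions `i` and `j`, with the
sign for which it is nonnegative if `f` is submodular. -/
def secondDiff (A : Finset (Fin d)) (i j : Fin d) (f : Finset (Fin d) → ℝ) : ℝ :=
  f (insert i A) + f (insert j A) - f A - f (insert i (insert j A))

/-- Submodularity of a set function, expressed through its second differences. This local form
implies the decrease of gains `IsSubmodular.gain_anti`. -/
def IsSubmodular (f : Finset (Fin d) → ℝ) : Prop :=
  ∀ (A : Finset (Fin d)) (i j : Fin d), i ∉ A → j ∉ A → i ≠ j → 0 ≤ secondDiff A i j f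

theorem isSubmodular_supportValue (P : GenPerm d) : IsSubmodular (supportValue P) := by
  intro A i j hi hj hij
  -- A permutation sorting the sum of the indicators of `A ∪ {i}` and `A ∪ {j}` has both
  -- `A` and `A ∪ {i, j}` among its top sets.
  obtain ⟨σ, hσ⟩ := exists_perm_monovary fun k =>
    if k ∈ A then (2 : ℝ) else if k ∈ insert i (insert j A) then 1 else 0
  obtain ⟨p, hp, -, h⟩ := exists_supportValue_eq P σ
  have hA : IsTopSet σ A := by
    intro k l hk hkl
    by_contra hl
    have := hσ hkl
    simp only [hk, hl, if_true, if_false] at this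
    split_ifs at this <;> norm_num at this
  have hB : IsTopSet σ (insert i (insert j A)) := by
    intro k l hk hkl
    by_contra hl
    have hlA : l ∉ A := fun hlA => hl (by simp [hlA])
    have := hσ hkl
    simp only [hk, hl, hlA, if_true, if_false] at this
    split_ifs at this <;> norm_num at this
  have h1 := sum_le_supportValue P (insert i A) hp
  have h2 := sum_le_supportValue P (insert j A) hp
  have hij' : i ∉ insert j A := by simp [hij, hi]
  rw [secondDiff, h _ hA, h _ hB, Finset.sum_insert hij', Finset.sum_insert hj]
  rw [Finset.sum_insert hi] at h1
  rw [Finset.sum_insert hj] at h2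
  linarith

/-- The gain of adding an element to a set decreases as the set grows. -/
theorem IsSubmodular.gain_anti {f : Finset (Fin d) → ℝ} (hf : IsSubmodular f)
    {A B : Finset (Fin d)} (hAB : A ⊆ B) {i : Fin d} (hi : i ∉ B) :
    f (insert i B) - f B ≤ f (insert i A) - f A := by
  obtain ⟨C, rfl⟩ : ∃ C, B = C ∪ A := ⟨B, (Finset.union_eq_left.2 hAB).symm⟩
  clear hAB
  induction C using Finset.induction_on with
  | empty => simp
  | insert j C hj ih =>
    have hiC : i ∉ C ∪ A := fun h => hi (by rw [Finset.insert_union]; simp [h])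
    refine le_trans ?_ (ih hiC)
    rw [Finset.insert_union] at hi ⊢
    by_cases hjA : j ∈ C ∪ A
    · rw [Finset.insert_eq_of_mem hjA]
    · have := hf (C ∪ A) i j hiC hjA (by rintro rfl; simp at hi)
      rw [secondDiff] at this
      linarith

/-- The greedy points of a submodular function lie in its base polytope. -/
theorem IsSubmodular.sum_greedyPoint_le {f : Finset (Fin d) → ℝ} (hf : IsSubmodular f)
    (h0 : f ∅ = 0) (σ : Equiv.Perm (Fin d)) (S : Finset (Fin d)) :
    ∑ i ∈ S, greedyPoint f σ i ≤ f S := by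
  induction S using Finset.induction_on_min_value σ with
  | empty => simp [h0]
  | insert a s ha hmin ih =>
    rw [Finset.sum_insert ha]
    have hsub : s ⊆ indicesAbove σ a := fun x hx => mem_indicesAbove.2 <|
      lt_of_le_of_ne (hmin x hx) fun e => ha (σ.injective e ▸ hx)
    have := hf.gain_anti hsub (notMem_indicesAbove_self σ a)
    rw [greedyPoint]
    linarith

theorem sum_greedyPoint_eq {f : Finset (Fin d) → ℝ} (h0 : f ∅ = 0) {σ : Equiv.Perm (Fin d)}
    {S : Finset (Fin d)} (hS : IsTopSet σ S) : ∑ i ∈ S, greedyPoint f σ i = f S := by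
  induction S using Finset.induction_on_min_value σ with
  | empty => simp [h0]
  | insert a s ha hmin ih =>
    have hlt : ∀ x ∈ s, σ a < σ x := fun x hx =>
      lt_of_le_of_ne (hmin x hx) fun e => ha (σ.injective e ▸ hx)
    have hs : s = indicesAbove σ a := by
      ext x
      rw [mem_indicesAbove]
      refine ⟨hlt x, fun hx => ?_⟩
      have := hS (Finset.mem_insert_self a s) hx
      rcases Finset.mem_insert.1 this with rfl | h
      · exact absurd hx (lt_irrefl _)
      · exact h
    rw [Finset.sum_insert ha, ih (hs ▸ isTopSet_indicesAbove σ a), greedyPoint, ← hs]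
    ring

/-! ### Realization of submodular functions -/

/-- Summation by parts: a sum with nonnegative tails stays nonnegative when its terms are
weighted by a nonnegative monotone sequence. -/
theorem sum_mul_nonneg_of_tail_nonneg : ∀ (n : ℕ) (u z : Fin n → ℝ), Monotone u →
    (∀ k, 0 ≤ u k) → (∀ m, 0 ≤ ∑ k ∈ Finset.univ.filter (m ≤ ·), z k) → 0 ≤ ∑ k, u k * z k
  | 0, _, _, _, _, _ => by simp
  | n + 1, u, z, hu, hu0, hz => by
    have ih := sum_mul_nonneg_of_tail_nonneg n (fun k => u k.succ - u 0) (fun k => z k.succ)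
      (fun a b hab => sub_le_sub_right (hu (Fin.succ_le_succ_iff.2 hab)) _)
      (fun k => sub_nonneg.2 (hu (Fin.zero_le _))) fun m => by
        have := hz m.succ
        rw [Finset.sum_filter, Fin.sum_univ_succ] at this
        rw [Finset.sum_filter]
        simpa using this
    have h0 := hz 0
    have hall : (Finset.univ.filter ((0 : Fin (n + 1)) ≤ ·)) = Finset.univ := by
      ext k; simp
    rw [hall] at h0
    have key : ∑ k, u k * z k =
        u 0 * ∑ k, z k + ∑ k : Fin n, (u k.succ - u 0) * z k.succ := by
      rw [Fin.sum_univ_succ, Fin.sum_univ_succ, mul_add, Finset.mul_sum, add_assoc,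
        ← Finset.sum_add_distrib]
      congr 1
      exact Finset.sum_congr rfl fun k _ => by ring
    rw [key]
    exact add_nonneg (mul_nonneg (hu0 0) h0) ih

/-- Summation by parts along the order given by `σ`. -/
theorem dotProduct_nonneg_of_isTopSet {w y : Fin d → ℝ} {σ : Equiv.Perm (Fin d)}
    (hw : Monovary w σ) (htop : ∀ S, IsTopSet σ S → 0 ≤ ∑ i ∈ S, y i) (htot : ∑ i, y i = 0) :
    0 ≤ w ⬝ᵥ y := by
  -- Since the entries of `y` add up to zero, the weights may be shifted to become nonnegative.
  obtain ⟨c, hc⟩ : ∃ c : ℝ, ∀ i, 0 ≤ w i + c := by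
    refine ⟨∑ i, |w i|, fun i => ?_⟩
    have := Finset.single_le_sum (f := fun i => |w i|) (fun j _ => abs_nonneg _)
      (Finset.mem_univ i)
    linarith [neg_abs_le (w i)]
  have hmono : Monotone fun k => w (σ.symm k) + c := by
    intro a b hab
    rcases hab.eq_or_lt with rfl | hab
    · exact le_rfl
    · have := hw (i := σ.symm a) (j := σ.symm b) (by simpa using hab)
      simpa using this
  have key := sum_mul_nonneg_of_tail_nonneg d _ (fun k => y (σ.symm k)) hmono (fun k => hc _)
    fun m => by
      have h := htop (Finset.univ.filter fun i => m ≤ σ i) fun i j hi hij => by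
        simp only [Finset.mem_filter, Finset.mem_univ, true_and] at hi ⊢
        exact hi.trans hij.le
      rw [Finset.sum_filter] at h ⊢
      rw [← Equiv.sum_comp σ]
      simpa using h
  rw [← Equiv.sum_comp σ] at key
  simp only [Equiv.symm_apply_apply, add_mul, Finset.sum_add_distrib, ← Finset.mul_sum, htot,
    mul_zero, add_zero] at key
  exact key

/-- The greedy algorithm is optimal for submodular functions. -/
theorem IsSubmodular.dotProduct_greedyPoint_le {f : Finset (Fin d) → ℝ} (hf : IsSubmodular f)
    (h0 : f ∅ = 0) {w : Fin d → ℝ} {σ : Equiv.Perm (Fin d)} (hw : Monovary w σ)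
    (τ : Equiv.Perm (Fin d)) : w ⬝ᵥ greedyPoint f τ ≤ w ⬝ᵥ greedyPoint f σ := by
  have := dotProduct_nonneg_of_isTopSet (y := greedyPoint f σ - greedyPoint f τ) hw
    (fun S hS => by
      simp only [Pi.sub_apply, Finset.sum_sub_distrib, sum_greedyPoint_eq h0 hS, sub_nonneg]
      exact hf.sum_greedyPoint_le h0 τ S)
    (by
      simp only [Pi.sub_apply, Finset.sum_sub_distrib, sum_greedyPoint_eq h0 (isTopSet_univ _),
        sub_self])
  rw [dotProduct_sub] at this
  linarith

/-- The set function `S ↦ d + (d - 1) + ⋯ + (d - |S| + 1)` that belongs to the permutahedron. -/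
def permutahedronRank (S : Finset (Fin d)) : ℝ :=
  ∑ k ∈ Finset.range S.card, ((d : ℝ) - k)

theorem permutahedronRank_insert {S : Finset (Fin d)} {i : Fin d} (hi : i ∉ S) :
    permutahedronRank (insert i S) = permutahedronRank S + ((d : ℝ) - S.card) := by
  rw [permutahedronRank, Finset.card_insert_of_notMem hi, Finset.sum_range_succ,
    permutahedronRank]

theorem greedyPoint_permutahedronRank (σ : Equiv.Perm (Fin d)) :
    greedyPoint permutahedronRank σ = permPoint σ := by
  funext i
  have hcard : (indicesAbove σ i).card = d - 1 - (σ i : ℕ) := by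
    rw [← Fin.card_Ioi, ← Finset.card_map σ.toEmbedding]
    congr 1
    ext k
    simp only [Finset.mem_map, mem_indicesAbove, Finset.mem_Ioi, Equiv.coe_toEmbedding]
    exact ⟨by rintro ⟨j, hj, rfl⟩; exact hj, fun hk => ⟨σ.symm k, by simpa using hk, by simp⟩⟩
  have hcard' : ((indicesAbove σ i).card : ℝ) + (σ i : ℕ) + 1 = d := by
    have h1 := (σ i).isLt
    exact_mod_cast (by omega : (indicesAbove σ i).card + (σ i : ℕ) + 1 = d)
  rw [greedyPoint, permutahedronRank_insert (notMem_indicesAbove_self σ i), permPoint]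
  linarith

theorem secondDiff_permutahedronRank {A : Finset (Fin d)} {i j : Fin d} (hi : i ∉ A)
    (hj : j ∉ A) (hij : i ≠ j) : secondDiff A i j permutahedronRank = 1 := by
  have hij' : i ∉ insert j A := by simp [hij, hi]
  rw [secondDiff, permutahedronRank_insert hij', permutahedronRank_insert hi,
    permutahedronRank_insert hj, Finset.card_insert_of_notMem hj]
  push_cast
  ring

/-- A large multiple of the rank function of the permutahedron dominates any set function in the
sense that the difference is submodular. -/
theorem exists_isSubmodular_sub (f : Finset (Fin d) → ℝ) :
    ∃ r : ℝ, 0 < r ∧ IsSubmodular fun S => r * permutahedronRank S - f S := by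
  obtain ⟨M, hM⟩ := (Set.finite_range fun t : Finset (Fin d) × Fin d × Fin d =>
    secondDiff t.1 t.2.1 t.2.2 f).bddAbove
  refine ⟨max M 1, lt_max_of_lt_right one_pos, fun A i j hi hj hij => ?_⟩
  have h1 : secondDiff A i j f ≤ M := hM ⟨(A, i, j), rfl⟩
  have h2 := secondDiff_permutahedronRank hi hj hij
  have h3 : secondDiff A i j (fun S => max M 1 * permutahedronRank S - f S) =
      max M 1 * secondDiff A i j permutahedronRank - secondDiff A i j f := by
    simp only [secondDiff]
    ring
  rw [h3, h2]
  linarith [le_max_left M 1]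

/-- The greedy points of a normalized submodular function `f` span a generalized permutahedron. The
complementary summand comes from `g = r * permutahedronRank - f`: greedy points are linear in the
set function, so those of `f` and `g` along the same order add up to a vertex of `r • Π_d`. -/
theorem IsSubmodular.isGenPerm {f : Finset (Fin d) → ℝ} (hf : IsSubmodular f) (h0 : f ∅ = 0) :
    IsGenPerm (convexHull ℝ (Set.range (greedyPoint f))) := by
  obtain ⟨r, hr, hg⟩ := exists_isSubmodular_sub f
  set g : Finset (Fin d) → ℝ := fun S => r * permutahedronRank S - f S with hgdef
  have hg0 : g ∅ = 0 := by simp [hgdef, h0, permutahedronRank]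
  have hadd : ∀ σ, greedyPoint g σ + greedyPoint f σ = r • permPoint σ := by
    intro σ
    rw [← greedyPoint_permutahedronRank]
    funext i
    simp only [hgdef, greedyPoint, Pi.add_apply, Pi.smul_apply, smul_eq_mul]
    ring
  refine ⟨⟨_, Set.finite_range _, rfl⟩, r, hr, convexHull ℝ (Set.range (greedyPoint g)),
    ⟨_, Set.finite_range _, rfl⟩, ?_⟩
  rw [← convexHull_add, permutahedron, ← convexHull_smul]
  apply Set.Subset.antisymm
  · refine convexHull_min ?_ (convex_convexHull ℝ _)
    rintro _ ⟨_, ⟨τ, rfl⟩, _, ⟨ρ, rfl⟩, rfl⟩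
    refine mem_of_forall_exists_dotProduct_le (convex_convexHull ℝ _)
      ((Set.finite_range _).smul_set.isClosed_convexHull ℝ) fun w => ?_
    obtain ⟨σ, hσ⟩ := exists_perm_monovary w
    refine ⟨r • permPoint σ, subset_convexHull ℝ _ (Set.smul_mem_smul_set ⟨σ, rfl⟩), ?_⟩
    rw [← hadd, dotProduct_add, dotProduct_add]
    exact add_le_add (hg.dotProduct_greedyPoint_le hg0 hσ τ)
      (hf.dotProduct_greedyPoint_le h0 hσ ρ)
  · refine convexHull_mono ?_
    rintro _ ⟨_, ⟨σ, rfl⟩, rfl⟩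
    exact ⟨_, ⟨σ, rfl⟩, _, ⟨σ, rfl⟩, hadd σ⟩

/-- Every normalized submodular function consists of the support values of a generalized
permutahedron. -/
theorem IsSubmodular.exists_supportValue_eq {f : Finset (Fin d) → ℝ} (hf : IsSubmodular f)
    (h0 : f ∅ = 0) : ∃ P : GenPerm d, supportValue P = f := by
  let P : GenPerm d := ⟨_, hf.isGenPerm h0⟩
  refine ⟨P, funext fun S => ?_⟩
  obtain ⟨σ, hσ⟩ := exists_isTopSet S
  have hmem : greedyPoint f σ ∈ P.1 := subset_convexHull ℝ _ ⟨σ, rfl⟩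
  rw [supportValue_eq hmem, sum_greedyPoint_eq h0 hσ]
  intro x hx
  rw [sum_greedyPoint_eq h0 hσ, ← indicator_dotProduct]
  refine dotProduct_le_of_mem_convexHull ?_ x hx
  rintro _ ⟨τ, rfl⟩
  rw [indicator_dotProduct]
  exact hf.sum_greedyPoint_le h0 τ S

/-! ### Signed Minkowski sums of simplices -/

/-- Summation over subsets is an invertible transformation of set functions. -/
theorem exists_sum_powerset_eq (G : Finset (Fin d) → ℝ) :
    ∃ a : Finset (Fin d) → ℝ, ∀ K, ∑ J ∈ K.powerset, a J = G K := by
  let T : (Finset (Fin d) → ℝ) →ₗ[ℝ] (Finset (Fin d) → ℝ) :=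
    { toFun := fun a K => ∑ J ∈ K.powerset, a J
      map_add' := fun a b => by funext K; simp [Finset.sum_add_distrib]
      map_smul' := fun c a => by funext K; simp [Finset.mul_sum] }
  have hinj : Function.Injective T := by
    rw [← LinearMap.ker_eq_bot, LinearMap.ker_eq_bot']
    intro a ha
    funext K
    induction K using Finset.strongInduction with
    | H K ih =>
      have hK : ∑ J ∈ K.powerset, a J = 0 := congrFun ha K
      rwa [Finset.sum_eq_single_of_mem K (Finset.mem_powerset_self K)] at hK
      intro J hJ hne
      exact ih J ((Finset.mem_powerset.1 hJ).ssubset_of_ne hne)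
  obtain ⟨a, ha⟩ := LinearMap.injective_iff_surjective.1 hinj G
  exact ⟨a, congrFun ha⟩

/-- The support values of the standard simplices span the set functions that vanish at `∅`. -/
theorem exists_eq_sum_supportValue_simplex {g : Finset (Fin d) → ℝ} (h0 : g ∅ = 0) :
    ∃ a : Finset (Fin d) → ℝ, ∀ S, g S = ∑ I, a I * supportValue (simplex I) S := by
  obtain ⟨a, ha⟩ := exists_sum_powerset_eq fun K => g Finset.univ - g Kᶜ
  refine ⟨a, fun S => ?_⟩
  have h1 := ha Finset.univ
  rw [Finset.powerset_univ, Finset.compl_univ, h0, sub_zero] at h1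
  -- `Δ_I` has support value `0` at `S` exactly when `I` is contained in the complement of `S`.
  have h2 : ∑ J ∈ Sᶜ.powerset, a J = ∑ J, if J ⊆ Sᶜ then a J else 0 := by
    rw [← Finset.sum_filter]
    congr 1
    ext J
    simp
  rw [ha, compl_compl, ← h1] at h2
  rw [sub_eq_iff_eq_add, ← sub_eq_iff_eq_add', ← Finset.sum_sub_distrib] at h2
  rw [← h2]
  refine Finset.sum_congr rfl fun I _ => ?_
  have : I ⊆ Sᶜ ↔ ¬ (I ∩ S).Nonempty := by
    rw [Finset.not_nonempty_iff_eq_empty, ← Finset.disjoint_iff_inter_eq_empty,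
      Finset.subset_compl_iff_disjoint_right]
  rw [supportValue_simplex]
  by_cases h : (I ∩ S).Nonempty <;> simp [h, this]

theorem minkowskiFunctional_map_linearComb (φ : MinkowskiFunctional d) (P Q : GenPerm d)
    (a b : ℝ≥0) : φ.1 (a • P + b • Q) = a * φ.1 P + b * φ.1 Q :=
  φ.2 P Q a b

theorem minkowskiFunctional_map_simplex_empty (φ : MinkowskiFunctional d) :
    φ.1 (simplex ∅) = 0 := by
  have h : (0 : ℝ≥0) • simplex (d := d) ∅ + (0 : ℝ≥0) • simplex ∅ = simplex ∅ :=
    eq_of_supportValue_eq <| funext fun S => by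
      rw [supportValue_linearComb, supportValue_simplex]
      simp
  rw [← h, minkowskiFunctional_map_linearComb φ]
  simp

/-- Minkowski sums of dilated standard simplices, as seen by support values and by Minkowski
linear functionals. -/
theorem exists_minkowskiSum_simplex (b : Finset (Fin d) → ℝ≥0)
    (s : Finset (Finset (Fin d))) : ∃ Q : GenPerm d,
      (∀ S, supportValue Q S = ∑ I ∈ s, b I * supportValue (simplex I) S) ∧
      ∀ φ : MinkowskiFunctional d, φ.1 Q = ∑ I ∈ s, b I * φ.1 (simplex I) := by
  induction s using Finset.induction_on with
  | empty =>
    exact ⟨simplex ∅, fun S => by simp [supportValue_simplex], fun φ => by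
      simp [minkowskiFunctional_map_simplex_empty φ]⟩
  | insert I s hI ih =>
    obtain ⟨Q, hQ, hφ⟩ := ih
    exact ⟨b I • simplex I + (1 : ℝ≥0) • Q,
      fun S => by rw [supportValue_linearComb, hQ, Finset.sum_insert hI]; simp,
      fun φ => by rw [minkowskiFunctional_map_linearComb φ, hφ, Finset.sum_insert hI]; simp⟩

/-- A linear relation between support values is inherited by every Minkowski linear functional,
since it amounts to an equality of two Minkowski sums. -/
theorem minkowskiFunctional_apply_eq_sum (φ : MinkowskiFunctional d) {P : GenPerm d}
    {a : Finset (Fin d) → ℝ}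
    (h : ∀ S, supportValue P S = ∑ I, a I * supportValue (simplex I) S) :
    φ.1 P = ∑ I, a I * φ.1 (simplex I) := by
  obtain ⟨Q, hQ, hφQ⟩ := exists_minkowskiSum_simplex (fun I => (a I).toNNReal) Finset.univ
  obtain ⟨R, hR, hφR⟩ := exists_minkowskiSum_simplex (fun I => (-a I).toNNReal) Finset.univ
  have ha : ∀ I, a I = (a I).toNNReal - (-a I).toNNReal := fun I => by
    rw [Real.coe_toNNReal', Real.coe_toNNReal', max_zero_sub_max_neg_zero_eq_self]
  have key : (1 : ℝ≥0) • P + (1 : ℝ≥0) • R = (1 : ℝ≥0) • Q + (0 : ℝ≥0) • Q :=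
    eq_of_supportValue_eq <| funext fun S => by
      rw [supportValue_linearComb, supportValue_linearComb, h, hQ, hR]
      simp only [NNReal.coe_one, NNReal.coe_zero, one_mul, zero_mul, add_zero]
      rw [← Finset.sum_add_distrib]
      refine Finset.sum_congr rfl fun I _ => ?_
      rw [← add_mul]
      congr 1
      linarith [ha I]
  have := congrArg φ.1 key
  rw [minkowskiFunctional_map_linearComb φ, minkowskiFunctional_map_linearComb φ, hφQ, hφR] at this
  simp only [NNReal.coe_one, NNReal.coe_zero, one_mul, zero_mul, add_zero] at this
  rw [← eq_sub_iff_add_eq, ← Finset.sum_sub_distrib] at this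
  rw [this]
  refine Finset.sum_congr rfl fun I _ => ?_
  rw [← sub_mul, ← ha]

/-- Minkowski linear functionals are determined by their values at standard simplices. -/
theorem minkowskiFunctional_ext_simplex {φ ψ : MinkowskiFunctional d}
    (h : ∀ I, φ.1 (simplex I) = ψ.1 (simplex I)) : φ = ψ := by
  refine Subtype.ext (funext fun P => ?_)
  obtain ⟨a, ha⟩ := exists_eq_sum_supportValue_simplex (supportValue_empty P)
  rw [minkowskiFunctional_apply_eq_sum φ ha, minkowskiFunctional_apply_eq_sum ψ ha]
  simp only [h]

/-! ### Finitely generated cones are polyhedral -/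

section Polyhedral

variable {M : Type*} [AddCommGroup M] [Module ℝ M]

theorem isPolyhedralCone_bot [FiniteDimensional ℝ M] :
    IsPolyhedralCone (⊥ : PointedCone ℝ M) := by
  let b := Module.finBasis ℝ M
  refine ⟨Set.range b.coord ∪ Set.range fun i => -b.coord i,
    (Set.finite_range _).union (Set.finite_range _), fun x => ⟨?_, fun h => ?_⟩⟩
  · rintro hx f -
    rw [Submodule.mem_bot] at hx
    simp [hx]
  · rw [Submodule.mem_bot, ← b.forall_coord_eq_zero_iff]
    intro i
    have h1 := h (b.coord i) (Or.inl ⟨i, rfl⟩)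
    have h2 := h (-b.coord i) (Or.inr ⟨i, rfl⟩)
    rw [LinearMap.neg_apply] at h2
    linarith

/-- Fourier–Motzkin elimination: adding a generator to a polyhedral cone gives a polyhedral
cone. -/
theorem IsPolyhedralCone.hull_insert {s : Set M}
    (hs : IsPolyhedralCone (PointedCone.hull ℝ s)) (v : M) :
    IsPolyhedralCone (PointedCone.hull ℝ (insert v s)) := by
  obtain ⟨F, hF, hmem⟩ := hs
  refine ⟨{f ∈ F | 0 ≤ f v} ∪ Set.image2 (fun f g => f v • g - g v • f) {f ∈ F | 0 < f v}
    {g ∈ F | g v < 0}, (hF.sep _).union ((hF.sep _).image2 _ (hF.sep _)), fun x => ?_⟩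
  rw [Submodule.mem_span_insert]
  constructor
  · rintro ⟨a, z, hz, rfl⟩ f hf
    have hz' := (hmem z).1 hz
    have ha : (0 : ℝ) ≤ a := a.2
    have happ : ∀ f : Module.Dual ℝ M, f (a • v + z) = a * f v + f z := fun f => by
      rw [map_add]
      exact congrArg (· + f z) (f.map_smul (a : ℝ) v)
    rcases hf with ⟨hfF, hfv⟩ | ⟨f, ⟨hfF, hfv⟩, g, ⟨hgF, hgv⟩, rfl⟩
    · rw [happ]
      exact add_nonneg (mul_nonneg ha hfv) (hz' f hfF)
    · rw [LinearMap.sub_apply, LinearMap.smul_apply, LinearMap.smul_apply, happ, happ,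
        smul_eq_mul, smul_eq_mul]
      nlinarith [mul_nonneg hfv.le (hz' g hgF), mul_nonneg (neg_nonneg.2 hgv.le) (hz' f hfF)]
  · intro hx
    -- The least `t ≥ 0` for which `x - t v` satisfies the inequalities with `g v < 0`.
    obtain ⟨t, ht, hmax⟩ := Set.exists_max_image
      (insert 0 ((fun g : Module.Dual ℝ M => g x / g v) '' {g ∈ F | g v < 0})) id
      (((hF.sep _).image _).insert 0) ⟨0, Set.mem_insert _ _⟩
    have ht0 : 0 ≤ t := hmax 0 (Set.mem_insert _ _)
    refine ⟨⟨t, ht0⟩, x - t • v, (hmem _).2 fun f hf => ?_, ?_⟩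
    · rw [map_sub, map_smul, smul_eq_mul, sub_nonneg]
      rcases lt_trichotomy (f v) 0 with hfv | hfv | hfv
      · have h := hmax (f x / f v) (Set.mem_insert_of_mem _ ⟨f, ⟨hf, hfv⟩, rfl⟩)
        exact (div_le_iff_of_neg hfv).1 h
      · rw [hfv, mul_zero]
        exact hx f (Or.inl ⟨hf, hfv.ge⟩)
      · rcases ht with rfl | ⟨g, ⟨hg, hgv⟩, rfl⟩
        · rw [zero_mul]
          exact hx f (Or.inl ⟨hf, hfv.le⟩)
        · have h := hx _ (Or.inr ⟨f, ⟨hf, hfv⟩, g, ⟨hg, hgv⟩, rfl⟩)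
          rw [LinearMap.sub_apply, LinearMap.smul_apply, LinearMap.smul_apply, smul_eq_mul,
            smul_eq_mul] at h
          rw [div_mul_eq_mul_div, div_le_iff_of_neg hgv]
          linarith
    · exact (add_sub_cancel (t • v) x).symm

/-- Weyl's half of the Minkowski–Weyl theorem. -/
theorem isPolyhedralCone_hull [FiniteDimensional ℝ M] {s : Set M} (hs : s.Finite) :
    IsPolyhedralCone (PointedCone.hull ℝ s) := by
  induction s, hs using Set.Finite.induction_on with
  | empty =>
    rw [PointedCone.hull, Submodule.span_empty]
    exact isPolyhedralCone_bot
  | insert _ _ ih => exact ih.hull_insert _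

end Polyhedral

/-! ### The functionals given by second differences -/

/-- The Minkowski linear functional that takes the second difference of the support values. -/
noncomputable def secondDiffFunctional (A : Finset (Fin d)) (i j : Fin d) :
    MinkowskiFunctional d :=
  ⟨fun P => secondDiff A i j (supportValue P), fun P Q a b => by
    simp only [secondDiff, supportValue_linearComb]
    ring⟩

theorem secondDiff_supportValue_simplex (T I : Finset (Fin d)) (i j : Fin d) :
    secondDiff Tᶜ i j (supportValue (simplex I)) =
      if ({i, j} : Finset (Fin d)) ⊆ I ∧ I ⊆ T then 1 else 0 := by
  have hins : ∀ (k : Fin d) (B : Finset (Fin d)),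
      (I ∩ insert k B).Nonempty ↔ k ∈ I ∨ (I ∩ B).Nonempty := by
    intro k B
    by_cases hk : k ∈ I
    · simp [hk, Finset.inter_insert_of_mem]
    · simp [hk, Finset.inter_insert_of_notMem]
  have hT : (I ∩ Tᶜ).Nonempty ↔ ¬ I ⊆ T := by
    rw [← Finset.sdiff_eq_inter_compl, Finset.sdiff_nonempty]
  simp only [secondDiff, supportValue_simplex, hins, hT, Finset.insert_subset_iff,
    Finset.singleton_subset_iff]
  by_cases h1 : i ∈ I <;> by_cases h2 : j ∈ I <;> by_cases h3 : I ⊆ T <;> simp [h1, h2, h3]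

/-- The functional with the ray values of `(E, T)` is a second difference at the complement
of `T`. -/
theorem HasRayValues.exists_apply_eq {p : EdgePair d} {v : MinkowskiFunctional d}
    (hv : HasRayValues p v) : ∃ i j, i ≠ j ∧ p.1.1 = {i, j} ∧ i ∉ p.1.2ᶜ ∧ j ∉ p.1.2ᶜ ∧
      ∀ P, v.1 P = secondDiff p.1.2ᶜ i j (supportValue P) := by
  obtain ⟨i, j, hij, hE⟩ := Finset.card_eq_two.1 p.2.1
  have hsub := p.2.2
  rw [hE, Finset.insert_subset_iff, Finset.singleton_subset_iff] at hsub
  refine ⟨i, j, hij, hE, by simp [hsub.1], by simp [hsub.2], fun P => ?_⟩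
  have : v = secondDiffFunctional p.1.2ᶜ i j := minkowskiFunctional_ext_simplex fun I => by
    rw [hv I, hE]
    exact (secondDiff_supportValue_simplex p.1.2 I i j).symm
  rw [this]
  rfl

theorem existsUnique_hasRayValues (p : EdgePair d) :
    ∃! v : MinkowskiFunctional d, HasRayValues p v := by
  obtain ⟨i, j, -, hE⟩ := Finset.card_eq_two.1 p.2.1
  refine ⟨secondDiffFunctional p.1.2ᶜ i j, fun I => ?_, fun w hw =>
    minkowskiFunctional_ext_simplex fun I => ?_⟩
  · rw [hE]
    exact secondDiff_supportValue_simplex p.1.2 I i j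
  · rw [hw I, hE]
    exact (secondDiff_supportValue_simplex p.1.2 I i j).symm

theorem HasRayValues.isPositive {p : EdgePair d} {v : MinkowskiFunctional d}
    (hv : HasRayValues p v) : IsPositive v.1 := by
  obtain ⟨i, j, hij, -, hi, hj, h⟩ := hv.exists_apply_eq
  intro P
  rw [h]
  exact isSubmodular_supportValue P _ i j hi hj hij

theorem HasRayValues.isTranslationInvariant {p : EdgePair d} {v : MinkowskiFunctional d}
    (hv : HasRayValues p v) : IsTranslationInvariant v.1 := by
  obtain ⟨i, j, hij, -, hi, hj, h⟩ := hv.exists_apply_eq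
  intro P t
  have hij' : i ∉ insert j p.1.2ᶜ := by rw [Finset.mem_insert]; tauto
  simp only [h, secondDiff, supportValue_translate, Finset.sum_insert hi, Finset.sum_insert hj,
    Finset.sum_insert hij']
  ring

theorem exists_hasRayValues_secondDiff {A : Finset (Fin d)} {i j : Fin d} (hi : i ∉ A)
    (hj : j ∉ A) (hij : i ≠ j) : ∃ p : EdgePair d, ∀ v : MinkowskiFunctional d,
      HasRayValues p v → ∀ I, v.1 (simplex I) = secondDiff A i j (supportValue (simplex I)) := by
  refine ⟨⟨({i, j}, Aᶜ), Finset.card_pair hij, ?_⟩, fun v hv I => ?_⟩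
  · simp [Finset.insert_subset_iff, hi, hj]
  · have := secondDiff_supportValue_simplex Aᶜ I i j
    rw [compl_compl] at this
    rw [this]
    exact hv I

/-! ### The cone of positive functionals -/

/-- Evaluation of Minkowski linear functionals at the standard simplices. -/
def simplexEval (d : ℕ) : MinkowskiFunctional d →ₗ[ℝ] (Finset (Fin d) → ℝ) where
  toFun φ I := φ.1 (simplex I)
  map_add' _ _ := rfl
  map_smul' _ _ := rfl

theorem simplexEval_injective : Function.Injective (simplexEval d) :=
  fun _ _ h => minkowskiFunctional_ext_simplex fun I => congrFun h I

instance : FiniteDimensional ℝ (MinkowskiFunctional d) :=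
  FiniteDimensional.of_injective _ simplexEval_injective

theorem exists_dual_eq_sum (f : Module.Dual ℝ (MinkowskiFunctional d)) :
    ∃ a : Finset (Fin d) → ℝ, ∀ φ, f φ = ∑ I, a I * φ.1 (simplex I) := by
  obtain ⟨g, hg⟩ := LinearMap.exists_leftInverse_of_injective (simplexEval d)
    (LinearMap.ker_eq_bot.2 simplexEval_injective)
  refine ⟨fun I => f (g (Pi.single I 1)), fun φ => ?_⟩
  have h1 : g (simplexEval d φ) = φ := LinearMap.congr_fun hg φ
  have h2 := LinearMap.pi_apply_eq_sum_univ (f ∘ₗ g) (simplexEval d φ)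
  rw [LinearMap.comp_apply, h1] at h2
  rw [h2]
  refine Finset.sum_congr rfl fun I _ => ?_
  rw [smul_eq_mul, mul_comm, LinearMap.comp_apply]
  congr 4
  funext J
  simp [Pi.single_apply, eq_comm]

/-- By duality: a linear form on functionals that is nonnegative at all `v p` is a signed sum of
evaluations at simplices whose support values form a submodular function, hence it is the
evaluation at a generalized permutahedron. -/
theorem mem_hull_of_isPositive {v : EdgePair d → MinkowskiFunctional d}
    (hv : ∀ p, HasRayValues p (v p)) {φ : MinkowskiFunctional d} (hφ : IsPositive φ.1) :
    φ ∈ PointedCone.hull ℝ (Set.range v) := by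
  obtain ⟨s, -, hs⟩ := isPolyhedralCone_hull (Set.finite_range v)
  rw [hs]
  intro f hf
  obtain ⟨a, ha⟩ := exists_dual_eq_sum f
  have hsub : IsSubmodular fun S => ∑ I, a I * supportValue (simplex I) S := by
    intro A i j hi hj hij
    obtain ⟨p, hp⟩ := exists_hasRayValues_secondDiff hi hj hij
    have h1 : 0 ≤ f (v p) := (hs _).1 (Submodule.subset_span ⟨p, rfl⟩) f hf
    rw [ha] at h1
    simp only [hp _ (hv p), secondDiff] at h1
    simp only [secondDiff, ← Finset.sum_add_distrib, ← Finset.sum_sub_distrib]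
    refine h1.trans_eq (Finset.sum_congr rfl fun I _ => by ring)
  obtain ⟨P, hP⟩ := hsub.exists_supportValue_eq (by simp)
  rw [ha, ← minkowskiFunctional_apply_eq_sum φ (congrFun hP)]
  exact hφ P

theorem positiveInvariantCone_eq_hull {v : EdgePair d → MinkowskiFunctional d}
    (hv : ∀ p, HasRayValues p (v p)) :
    positiveInvariantCone d = PointedCone.hull ℝ (Set.range v) := by
  apply le_antisymm
  · exact fun φ hφ => mem_hull_of_isPositive hv hφ.1
  · refine Submodule.span_le.2 ?_
    rintro _ ⟨p, rfl⟩
    exact ⟨(hv p).isPositive, (hv p).isTranslationInvariant⟩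

theorem mem_hull_range_iff {v : EdgePair d → MinkowskiFunctional d} {φ : MinkowskiFunctional d} :
    φ ∈ PointedCone.hull ℝ (Set.range v) ↔
      ∃ c : EdgePair d → ℝ, (∀ p, 0 ≤ c p) ∧ φ = ∑ p, c p • v p := by
  rw [Submodule.mem_span_range_iff_exists_fun]
  constructor
  · rintro ⟨c, rfl⟩
    exact ⟨fun p => c p, fun p => (c p).2, rfl⟩
  · rintro ⟨c, hc, rfl⟩
    exact ⟨fun p => ⟨c p, hc p⟩, rfl⟩

/-! ### Extremality -/

/-- The rank function of the uniform matroid of rank two on `X`. -/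
def rankTwo (X S : Finset (Fin d)) : ℝ := ((min (S ∩ X).card 2 : ℕ) : ℝ)

theorem secondDiff_rankTwo (X : Finset (Fin d)) {A : Finset (Fin d)} {i j : Fin d}
    (hi : i ∉ A) (hj : j ∉ A) (hij : i ≠ j) :
    secondDiff A i j (rankTwo X) = if i ∈ X ∧ j ∈ X ∧ (A ∩ X).card = 1 then 1 else 0 := by
  have hcard : ∀ (k : Fin d) (B : Finset (Fin d)), k ∉ B →
      (insert k B ∩ X).card = (B ∩ X).card + if k ∈ X then 1 else 0 := by
    intro k B hk
    by_cases hkX : k ∈ X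
    · rw [Finset.insert_inter_of_mem hkX, Finset.card_insert_of_notMem (by simp [hk]), if_pos hkX]
    · rw [Finset.insert_inter_of_notMem hkX, if_neg hkX, add_zero]
  have hij' : i ∉ insert j A := by simp [hij, hi]
  simp only [secondDiff, rankTwo, hcard _ _ hij', hcard _ _ hi, hcard _ _ hj]
  generalize (A ∩ X).card = m
  by_cases h1 : i ∈ X <;> by_cases h2 : j ∈ X <;> simp only [h1, h2, if_true, if_false,
    add_zero, true_and, false_and, sub_self, add_sub_cancel_left, add_sub_cancel_right]
  rcases m with _ | _ | m
  · norm_num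
  · norm_num
  · rw [min_eq_right (by omega), min_eq_right (by omega), min_eq_right (by omega),
      if_neg (by omega)]
    norm_num

/-- Every `v_{E'}^{T'}` is separated from any other `v_E^T` by a generalized permutahedron: one of
the simplices `Δ_{T'}` and `Δ_{E'}`, or, if `E = E'` and `T'` is a proper subset of `T`, the
hypersimplex on `E ∪ {k}` for an element `k` of `T` outside `T'`. -/
theorem exists_genPerm_separating {p q : EdgePair d} (hpq : p ≠ q) : ∃ P : GenPerm d,
    (∀ v, HasRayValues p v → v.1 P = 0) ∧ ∀ w, HasRayValues q w → 0 < w.1 P := by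
  by_cases h1 : p.1.1 ⊆ q.1.2 ∧ q.1.2 ⊆ p.1.2
  · by_cases h2 : p.1.1 ⊆ q.1.1
    · have hE : p.1.1 = q.1.1 := Finset.eq_of_subset_of_card_le h2 (by rw [p.2.1, q.2.1])
      have hT : ¬ p.1.2 ⊆ q.1.2 := fun h =>
        hpq (Subtype.ext (Prod.ext hE (Finset.Subset.antisymm h h1.2)))
      obtain ⟨k, hkp, hkq⟩ := Finset.not_subset.1 hT
      set X := insert k p.1.1 with hX
      have hpX : p.1.2ᶜ ∩ X = ∅ := by
        rw [← Finset.disjoint_iff_inter_eq_empty, ← Finset.subset_compl_iff_disjoint_left,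
          compl_compl, hX, Finset.insert_subset_iff]
        exact ⟨hkp, p.2.2⟩
      have hqX : q.1.2ᶜ ∩ X = {k} := by
        rw [hX, Finset.inter_insert_of_mem (Finset.mem_compl.2 hkq)]
        have : q.1.2ᶜ ∩ p.1.1 = ∅ := by
          rw [← Finset.disjoint_iff_inter_eq_empty, ← Finset.subset_compl_iff_disjoint_left,
            compl_compl]
          exact h1.1
        rw [this]
        rfl
      have hsub : IsSubmodular (rankTwo X) := by
        intro A i j hi hj hij
        rw [secondDiff_rankTwo X hi hj hij]
        split_ifs <;> norm_num
      obtain ⟨P, hP⟩ := hsub.exists_supportValue_eq (by simp [rankTwo])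
      refine ⟨P, fun v hv => ?_, fun w hw => ?_⟩
      · obtain ⟨i, j, hij, -, hi, hj, h⟩ := hv.exists_apply_eq
        rw [h, hP, secondDiff_rankTwo X hi hj hij, hpX]
        simp
      · obtain ⟨i, j, hij, hij', hi, hj, h⟩ := hw.exists_apply_eq
        rw [h, hP, secondDiff_rankTwo X hi hj hij, hqX, if_pos]
        · exact one_pos
        · rw [hX, hE, hij']
          simp
    · exact ⟨simplex q.1.1, fun v hv => by rw [hv, if_neg fun h => h2 h.1],
        fun w hw => by rw [hw, if_pos ⟨subset_rfl, q.2.2⟩]; exact one_pos⟩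
  · exact ⟨simplex q.1.2, fun v hv => by rw [hv, if_neg h1],
      fun w hw => by rw [hw, if_pos ⟨q.2.2, subset_rfl⟩]; exact one_pos⟩

theorem HasRayValues.ne_zero {p : EdgePair d} {v : MinkowskiFunctional d}
    (hv : HasRayValues p v) : v ≠ 0 := by
  rintro rfl
  have := hv p.1.1
  rw [if_pos ⟨subset_rfl, p.2.2⟩] at this
  exact zero_ne_one this

theorem mem_hull_singleton_iff {M : Type*} [AddCommGroup M] [Module ℝ M] {x y : M} :
    y ∈ PointedCone.hull ℝ {x} ↔ ∃ c : ℝ, 0 ≤ c ∧ y = c • x := by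
  rw [Submodule.mem_span_singleton]
  constructor
  · rintro ⟨c, rfl⟩
    exact ⟨c, c.2, rfl⟩
  · rintro ⟨c, hc, rfl⟩
    exact ⟨⟨c, hc⟩, rfl⟩

theorem hull_singleton_smul {M : Type*} [AddCommGroup M] [Module ℝ M] {x : M} {c : ℝ}
    (hc : 0 < c) : PointedCone.hull ℝ {c • x} = PointedCone.hull ℝ {x} := by
  apply le_antisymm
  · refine Submodule.span_le.2 (Set.singleton_subset_iff.2 ?_)
    exact mem_hull_singleton_iff.2 ⟨c, hc.le, rfl⟩
  · refine Submodule.span_le.2 (Set.singleton_subset_iff.2 ?_)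
    exact mem_hull_singleton_iff.2
      ⟨c⁻¹, (inv_pos.2 hc).le, by rw [smul_smul, inv_mul_cancel₀ hc.ne', one_smul]⟩

theorem apply_sum_smul (v : EdgePair d → MinkowskiFunctional d) (c : EdgePair d → ℝ)
    (P : GenPerm d) : (∑ p, c p • v p).1 P = ∑ p, c p * (v p).1 P := by
  rw [AddSubmonoidClass.coe_finsetSum, Finset.sum_apply]
  rfl

theorem isRayOf_hull_singleton {v : EdgePair d → MinkowskiFunctional d}
    (hv : ∀ p, HasRayValues p (v p)) (p : EdgePair d) :
    IsRayOf (PointedCone.hull ℝ {v p}) (positiveInvariantCone d) := by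
  refine ⟨⟨?_, ?_⟩, v p, (hv p).ne_zero, rfl⟩
  · rw [positiveInvariantCone_eq_hull hv]
    exact Submodule.span_mono (Set.singleton_subset_iff.2 ⟨p, rfl⟩)
  · intro φ ψ a hφ hψ ha hsum
    have hφpos : IsPositive φ.1 := hφ.1
    have hψpos : IsPositive ψ.1 := hψ.1
    rw [positiveInvariantCone_eq_hull hv, mem_hull_range_iff] at hφ
    obtain ⟨c, hc, rfl⟩ := hφ
    obtain ⟨t, -, ht⟩ := mem_hull_singleton_iff.1 hsum
    have hzero : ∀ q, q ≠ p → c q = 0 := by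
      intro q hq
      obtain ⟨P, hp, hqP⟩ := exists_genPerm_separating hq.symm
      have h1 : a * (∑ r, c r • v r).1 P + ψ.1 P = t * (v p).1 P :=
        congrArg (fun χ : MinkowskiFunctional d => χ.1 P) ht
      rw [hp _ (hv p), mul_zero] at h1
      have h2 : (∑ r, c r • v r).1 P ≤ 0 := by
        by_contra h
        have := mul_pos ha (not_le.1 h)
        linarith [hψpos P]
      rw [apply_sum_smul] at h2
      have h3 : c q * (v q).1 P ≤ 0 := le_trans (Finset.single_le_sum
        (f := fun r => c r * (v r).1 P)
        (fun r _ => mul_nonneg (hc r) ((hv r).isPositive P)) (Finset.mem_univ q)) h2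
      exact le_antisymm (nonpos_of_mul_nonpos_left h3 (hqP _ (hv q))) (hc q)
    rw [Finset.sum_eq_single_of_mem p (Finset.mem_univ p) fun q _ hq => by
      rw [hzero q hq, zero_smul]]
    exact mem_hull_singleton_iff.2 ⟨c p, hc p, rfl⟩

theorem exists_eq_hull_of_isRayOf {v : EdgePair d → MinkowskiFunctional d}
    (hv : ∀ p, HasRayValues p (v p)) {R : PointedCone ℝ (MinkowskiFunctional d)}
    (hR : IsRayOf R (positiveInvariantCone d)) : ∃ p, R = PointedCone.hull ℝ {v p} := by
  obtain ⟨hface, x, hx, rfl⟩ := hR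
  have hmem : ∀ p, v p ∈ positiveInvariantCone d := fun p =>
    ⟨(hv p).isPositive, (hv p).isTranslationInvariant⟩
  have hxR : x ∈ PointedCone.hull ℝ {x} := Submodule.mem_span_singleton_self x
  have hxC := hface.le hxR
  rw [positiveInvariantCone_eq_hull hv, mem_hull_range_iff] at hxC
  obtain ⟨c, hc, hxc⟩ := hxC
  obtain ⟨p, hp⟩ : ∃ p, c p ≠ 0 := by
    by_contra! h
    exact hx (by simp [hxc, h])
  have hrest : ∑ q ∈ Finset.univ.erase p, c q • v q ∈ positiveInvariantCone d :=
    Submodule.sum_mem _ fun q _ => PointedCone.smul_mem _ (hc q) (hmem q)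
  have hvp : v p ∈ PointedCone.hull ℝ {x} := by
    refine hface.mem_of_smul_add_mem (hmem p) hrest ((hc p).lt_of_ne' hp) ?_
    rw [Finset.add_sum_erase _ (fun q => c q • v q) (Finset.mem_univ p), ← hxc]
    exact hxR
  obtain ⟨t, ht, hvt⟩ := mem_hull_singleton_iff.1 hvp
  have ht' : 0 < t := ht.lt_of_ne' fun h => (hv p).ne_zero (by rw [hvt, h, zero_smul])
  exact ⟨p, by rw [hvt, hull_singleton_smul ht']⟩

theorem injective_hull_singleton {v : EdgePair d → MinkowskiFunctional d}
    (hv : ∀ p, HasRayValues p (v p)) :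
    Function.Injective fun p => PointedCone.hull ℝ {v p} := by
  intro p q hpq
  by_contra hne
  have hmem : v q ∈ PointedCone.hull ℝ {v p} := by
    rw [show PointedCone.hull ℝ {v p} = PointedCone.hull ℝ {v q} from hpq]
    exact Submodule.mem_span_singleton_self _
  obtain ⟨t, -, ht⟩ := mem_hull_singleton_iff.1 hmem
  obtain ⟨P, hp, hq⟩ := exists_genPerm_separating hne
  have h1 : (v q).1 P = t * (v p).1 P :=
    congrArg (fun χ : MinkowskiFunctional d => χ.1 P) ht
  rw [hp _ (hv p), mul_zero] at h1
  exact (hq _ (hv q)).ne' h1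

end GenPermutahedra

open GenPermutahedra in
theorem theorem3p1 (d : ℕ) :
    -- for every pair `(E, T)` the prescribed values define a unique Minkowski linear functional
    (∀ p : EdgePair d, ∃! v : MinkowskiFunctional d, HasRayValues p v) ∧
    ∀ v : EdgePair d → MinkowskiFunctional d, (∀ p, HasRayValues p (v p)) →
      -- the characterization
      (∀ φ : MinkowskiFunctional d,
        (IsPositive φ.1 ∧ IsTranslationInvariant φ.1) ↔
          ∃ c : EdgePair d → ℝ, (∀ p, 0 ≤ c p) ∧ φ = ∑ p, c p • v p) ∧
      -- the cone is polyhedral and its rays are exactly those spanned by the `v p`,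
      -- different pairs giving different rays
      IsPolyhedralCone (positiveInvariantCone d) ∧
      (∀ R : PointedCone ℝ (MinkowskiFunctional d),
        IsRayOf R (positiveInvariantCone d) ↔ ∃ p, R = PointedCone.hull ℝ {v p}) ∧
      Function.Injective (fun p => PointedCone.hull ℝ {v p}) := by
  refine ⟨existsUnique_hasRayValues, fun v hv => ⟨fun φ => ?_, ?_, fun R => ⟨?_, ?_⟩, ?_⟩⟩
  · rw [← mem_hull_range_iff, ← positiveInvariantCone_eq_hull hv]
    rfl
  · rw [positiveInvariantCone_eq_hull hv]
    exact isPolyhedralCone_hull (Set.finite_range v)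
  · exact exists_eq_hull_of_isRayOf hv
  · rintro ⟨p, rfl⟩
    exact isRayOf_hull_singleton hv p
  · exact injective_hull_singleton hv
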